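/- Let $0<\alpha<1$, $\lambda>0$, $T>0$, and let $\varphi:[0,T]\to\mathbb{R}$ be continuous. Let $E_{\alpha,\alpha}(z)=\sum_{n=0}^{\infty} z^n/\Gamma(\alpha n+\alpha)$ be the Mittag-Leffler function. For $x\in C[0,T]$ let $${}^{C}D^{\alpha}_{0+}x(t)=\frac{d}{dt}\,\frac{1}{\Gamma(1-\alpha)}\int_0^t (t-s)^{-\alpha}\bigl(x(s)-x(0)\bigr)\,ds$$ be its Caputo derivative of order $\alpha$, wherever the derivative on the right exists (one-sided at $t=T$). Consider the fractional Voigt problem $${}^{C}D^{\alpha}_{0+}x(t)+\lambda x(t)=\varphi(t)\quad (0<t\le T),\qquad x(0)=0, \tag{1}$$ where the existence of ${}^{C}D^{\alpha}_{0+}x(t)$ for every $t\in(0,T]$ is part of the requirement. Then the function $$x(t)=\int_0^t (t-s)^{\alpha-1}E_{\alpha,\alpha}\bigl(-\lambda(t-s)^{\alpha}\bigr)\varphi(s)\,ds,\qquad 0\le t\le T, \tag{2}$$ is well defined (the integrand is integrable on $[0,t]$ for each $t\in[0,T]$), is continuous on $[0,T]$ and solves (1). Moreover, (1) and (2) are equivalent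 in $C[0,T]$: a function $x\in C[0,T]$ solves (1) if and only if it satisfies (2) for all $t\in[0,T]$. -/

import Mathlib

open Set MeasureTheory

/-- The two-parameter Mittag-Leffler function `E_{α,β}(z) = ∑ zⁿ / Γ(α n + β)` at real arguments
(the series converges for every `z` when `0 < α`). -/
noncomputable def mittagLeffler (α β z : ℝ) : ℝ :=
  ∑' n : ℕ, z ^ n / Real.Gamma (α * n + β)

/-- The `α`-exponential function `e_α^{μ t} = t ^ (α - 1) * E_{α,α}(μ t ^ α)`. -/
noncomputable def alphaExp (α μ t : ℝ) : ℝ :=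
  t ^ (α - 1) * mittagLeffler α α (μ * t ^ α)

/-- The left Riemann-Liouville fractional integral of order `β > 0` based at `0`. -/
noncomputable def rlIntegral (β : ℝ) (f : ℝ → ℝ) (t : ℝ) : ℝ :=
  1 / Real.Gamma β * ∫ s in (0 : ℝ)..t, (t - s) ^ (β - 1) * f s

/-- `x` has at `t` the Caputo derivative `d` of order `α` (for `0 < α < 1`), based at `0`, as a
function on `[0, T]`: the Riemann-Liouville derivative `(d/dt) I^{1-α} (x - x(0))` exists at `t`
and equals `d` (a one-sided derivative at the end points). Only values of `x` on `[0, T]` matter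
when `t ∈ [0, T]`. -/
def HasCaputoDerivAt (α T : ℝ) (x : ℝ → ℝ) (d t : ℝ) : Prop :=
  HasDerivWithinAt (rlIntegral (1 - α) (fun s => x s - x 0)) d (Icc 0 T) t

/-- `x` satisfies the fractional Voigt problem on `[0, T]`: at every `t ∈ (0, T]` the Caputo
derivative of `x` exists and `ᶜD^α x(t) + lam * x(t) = φ(t)`; moreover `x(0) = 0`. -/
def SolvesVoigt (α lam T : ℝ) (φ x : ℝ → ℝ) : Prop :=
  (∀ t ∈ Ioc 0 T, ∃ d : ℝ, HasCaputoDerivAt α T x d t ∧ d + lam * x t = φ t) ∧ x 0 = 0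

/-- The strain `t ↦ ∫₀ᵗ e_α^{-lam (t - s)} φ(s) ds`. -/
noncomputable def strain (α lam : ℝ) (φ : ℝ → ℝ) (t : ℝ) : ℝ :=
  ∫ s in (0 : ℝ)..t, alphaExp α (-lam) (t - s) * φ s

/-! Write I^b for `rlIntegral b`. The semigroup law I^a I^b = I^(a+b) on continuous functions turns
(1) into the Volterra equation x = I^α(φ - λx) (`solvesVoigt_iff_volterra`). Its Neumann series ∑
(-λ)^n I^(αn+α) φ converges uniformly on [0, T], because Γ outgrows every geometric sequence.
Summing the kernels under the integral gives the α-exponential, so the series is `strain`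
(`hasSum_strain`), and applying -λ I^α shifts it by one term (`strain_eq_volterra`). The difference
y of two solutions satisfies y = -λ I^α y; iterating forces y = 0. -/

/-! ### Fractional integrals of continuous functions -/

lemma intervalIntegrable_sub_rpow {b : ℝ} (hb : 0 < b) (r t : ℝ) :
    IntervalIntegrable (fun s => (t - s) ^ (b - 1)) volume r t := by
  have h := (intervalIntegral.intervalIntegrable_rpow' (a := t - r) (b := t - t)
    (show -1 < b - 1 by linarith)).comp_sub_left t
  simpa using h

lemma integral_sub_rpow {b : ℝ} (hb : 0 < b) (r t : ℝ) :
    ∫ s in r..t, (t - s) ^ (b - 1) = (t - r) ^ b / b := by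
  rw [intervalIntegral.integral_comp_sub_left (fun s => s ^ (b - 1)) t, sub_self,
    integral_rpow (Or.inl (by linarith))]
  simp [Real.zero_rpow hb.ne']

/-- The constant extension of a function on `[0, T]` to a continuous function on `ℝ`. -/
lemma exists_continuous_extension {T : ℝ} (hT : 0 ≤ T) {f : ℝ → ℝ}
    (hf : ContinuousOn f (Icc 0 T)) :
    ∃ g : ℝ → ℝ, Continuous g ∧ EqOn f g (Icc 0 T) ∧ ∃ M, ∀ s, |g s| ≤ M := by
  obtain ⟨M, hM⟩ := isCompact_Icc.exists_bound_of_continuousOn hf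
  refine ⟨IccExtend hT ((Icc 0 T).domRestrict f), hf.domRestrict.Icc_extend', fun s hs => ?_,
    M, fun s => ?_⟩
  · rw [IccExtend_of_mem hT _ hs]; rfl
  · exact hM _ (projIcc 0 T hT s).2

lemma intervalIntegrable_sub_rpow_mul {b T : ℝ} (hb : 0 < b) {f : ℝ → ℝ}
    (hf : ContinuousOn f (Icc 0 T)) {t : ℝ} (ht : t ∈ Icc 0 T) :
    IntervalIntegrable (fun s => (t - s) ^ (b - 1) * f s) volume 0 t := by
  refine (intervalIntegrable_sub_rpow hb 0 t).mul_continuousOn (hf.mono ?_)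
  rw [uIcc_of_le ht.1]
  exact Icc_subset_Icc le_rfl ht.2

lemma rlIntegral_congr (b : ℝ) {T : ℝ} {f g : ℝ → ℝ} (h : EqOn f g (Icc 0 T)) :
    EqOn (rlIntegral b f) (rlIntegral b g) (Icc 0 T) := by
  intro t ht
  unfold rlIntegral
  congr 1
  refine intervalIntegral.integral_congr fun s hs => ?_
  rw [uIcc_of_le ht.1] at hs
  simp only [h ⟨hs.1, hs.2.trans ht.2⟩]

@[simp] lemma rlIntegral_zero_right (b : ℝ) (f : ℝ → ℝ) : rlIntegral b f 0 = 0 := by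
  simp [rlIntegral]

lemma rlIntegral_one (f : ℝ → ℝ) (t : ℝ) : rlIntegral 1 f t = ∫ s in (0 : ℝ)..t, f s := by
  simp [rlIntegral]

lemma rlIntegral_const_mul (b c : ℝ) (f : ℝ → ℝ) (t : ℝ) :
    rlIntegral b (fun s => c * f s) t = c * rlIntegral b f t := by
  unfold rlIntegral
  rw [mul_left_comm, ← intervalIntegral.integral_const_mul c]
  simp_rw [mul_left_comm c]

lemma rlIntegral_sub {b T : ℝ} (hb : 0 < b) {f g : ℝ → ℝ} (hf : ContinuousOn f (Icc 0 T))
    (hg : ContinuousOn g (Icc 0 T)) {t : ℝ} (ht : t ∈ Icc 0 T) :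
    rlIntegral b (fun s => f s - g s) t = rlIntegral b f t - rlIntegral b g t := by
  unfold rlIntegral
  rw [← mul_sub, ← intervalIntegral.integral_sub (intervalIntegrable_sub_rpow_mul hb hf ht)
    (intervalIntegrable_sub_rpow_mul hb hg ht)]
  simp_rw [mul_sub]

lemma abs_rlIntegral_le {b T M : ℝ} (hb : 0 < b) {f : ℝ → ℝ}
    (hM : ∀ s ∈ Icc 0 T, |f s| ≤ M) {t : ℝ} (ht : t ∈ Icc 0 T) :
    |rlIntegral b f t| ≤ M * t ^ b / Real.Gamma (b + 1) := by
  have hΓ := Real.Gamma_pos_of_pos hb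
  have key : ‖∫ s in (0 : ℝ)..t, (t - s) ^ (b - 1) * f s‖
      ≤ ∫ s in (0 : ℝ)..t, (t - s) ^ (b - 1) * M := by
    refine intervalIntegral.norm_integral_le_of_norm_le ht.1 (Filter.Eventually.of_forall ?_)
      ((intervalIntegrable_sub_rpow hb 0 t).mul_const M)
    intro s hs
    rw [norm_mul, Real.norm_of_nonneg (Real.rpow_nonneg (sub_nonneg.2 hs.2) _)]
    exact mul_le_mul_of_nonneg_left (hM s ⟨hs.1.le, hs.2.trans ht.2⟩)
      (Real.rpow_nonneg (sub_nonneg.2 hs.2) _)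
  rw [intervalIntegral.integral_mul_const, integral_sub_rpow hb, sub_zero] at key
  rw [rlIntegral, abs_mul, abs_of_pos (by positivity), Real.Gamma_add_one hb.ne']
  calc _ ≤ 1 / Real.Gamma b * (t ^ b / b * M) := by gcongr; exact key
    _ = _ := by field_simp

/-- Substituting s = t u moves t out of the singular kernel into the continuous factor; dominated
convergence then applies. -/
lemma continuousOn_rlIntegral {b T : ℝ} (hb : 0 < b) {f : ℝ → ℝ}
    (hf : ContinuousOn f (Icc 0 T)) : ContinuousOn (rlIntegral b f) (Icc 0 T) := by
  rcases lt_or_ge T 0 with hT | hT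
  · simp [Icc_eq_empty_of_lt hT]
  obtain ⟨g, hg, hfg, M, hM⟩ := exists_continuous_extension hT hf
  have hcont : Continuous fun t => ∫ u in (0 : ℝ)..1, (1 - u) ^ (b - 1) * g (t * u) := by
    refine intervalIntegral.continuous_of_dominated_interval
      (bound := fun u => |(1 - u) ^ (b - 1)| * M) (fun t => ?_) (fun t => ?_) ?_ ?_
    · exact ((by fun_prop : Measurable fun u : ℝ => (1 - u) ^ (b - 1)).mul
        (by fun_prop)).aestronglyMeasurable
    · refine Filter.Eventually.of_forall fun u _ => ?_
      rw [norm_mul]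
      exact mul_le_mul_of_nonneg_left (hM _) (norm_nonneg _)
    · exact (intervalIntegrable_sub_rpow hb 0 1).abs.mul_const M
    · exact Filter.Eventually.of_forall fun u _ => by fun_prop
  have heq : EqOn (rlIntegral b f) (fun t => 1 / Real.Gamma b *
      (t ^ b * ∫ u in (0 : ℝ)..1, (1 - u) ^ (b - 1) * g (t * u))) (Icc 0 T) := by
    intro t ht
    rw [rlIntegral_congr b hfg ht]
    rcases ht.1.eq_or_lt with rfl | h0
    · simp [Real.zero_rpow hb.ne']
    unfold rlIntegral
    congr 1
    have h := intervalIntegral.integral_comp_mul_left (a := 0) (b := 1)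
      (fun s => (t - s) ^ (b - 1) * g s) h0.ne'
    rw [mul_zero, mul_one, smul_eq_mul] at h
    rw [eq_comm, inv_mul_eq_iff_eq_mul₀ h0.ne'] at h
    rw [h, ← intervalIntegral.integral_const_mul, ← intervalIntegral.integral_const_mul]
    refine intervalIntegral.integral_congr fun u hu => ?_
    rw [uIcc_of_le zero_le_one] at hu
    have e : t - t * u = t * (1 - u) := by ring
    have e' : t * t ^ (b - 1) = t ^ b := by
      rw [Real.rpow_sub_one h0.ne']; field_simp
    simp only [e, Real.mul_rpow h0.le (sub_nonneg.2 hu.2), ← e']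
    ring
  refine ContinuousOn.congr ?_ heq
  exact (continuous_const.mul ((Real.continuous_rpow_const hb.le).mul hcont)).continuousOn

/-! ### Beta integral and semigroup law -/

lemma integral_rpow_mul_rpow {a b : ℝ} (ha : 0 < a) (hb : 0 < b) {r t : ℝ} (hrt : r < t) :
    ∫ s in r..t, (t - s) ^ (a - 1) * (s - r) ^ (b - 1)
      = (t - r) ^ (a + b - 1) * (Real.Gamma a * Real.Gamma b / Real.Gamma (a + b)) := by
  have hc : 0 < t - r := sub_pos.2 hrt
  have h := Complex.betaIntegral_scaled (b : ℂ) (a : ℂ) hc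
  rw [Complex.betaIntegral_eq_Gamma_mul_div _ _ (by simpa) (by simpa)] at h
  have hl : ∫ x : ℝ in (0 : ℝ)..(t - r),
        (x : ℂ) ^ ((b : ℂ) - 1) * (((t - r : ℝ) : ℂ) - x) ^ ((a : ℂ) - 1)
      = ((∫ x in (0 : ℝ)..(t - r), x ^ (b - 1) * (t - r - x) ^ (a - 1) : ℝ) : ℂ) := by
    rw [← intervalIntegral.integral_ofReal]
    refine intervalIntegral.integral_congr fun x hx => ?_
    rw [uIcc_of_le hc.le] at hx
    simp only [Complex.ofReal_mul, Complex.ofReal_cpow hx.1,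
      Complex.ofReal_cpow (sub_nonneg.2 hx.2)]
    push_cast; rfl
  rw [hl, ← Complex.ofReal_add, Complex.Gamma_ofReal, Complex.Gamma_ofReal, Complex.Gamma_ofReal,
    ← Complex.ofReal_one, ← Complex.ofReal_sub, ← Complex.ofReal_cpow hc.le] at h
  norm_cast at h
  have hs := intervalIntegral.integral_comp_add_right (a := 0) (b := t - r)
    (fun s => (t - s) ^ (a - 1) * (s - r) ^ (b - 1)) r
  rw [zero_add, sub_add_cancel] at hs
  rw [← hs, add_comm a b, mul_comm (Real.Gamma a), ← h]
  refine intervalIntegral.integral_congr fun x _ => ?_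
  simp only [add_sub_cancel_right, sub_add_eq_sub_sub_swap, mul_comm]

/-- Tonelli: the kernel is nonnegative on the triangle r < s, and its inner integral s^b / b is
continuous in s. This licenses the Fubini swap in the semigroup law. -/
lemma integrable_iterated_kernel {a b t : ℝ} (ha : 0 < a) (hb : 0 < b) (ht : 0 ≤ t) :
    Integrable (fun p : ℝ × ℝ => (t - p.1) ^ (a - 1) *
        (Iio p.1).indicator (fun r => (p.1 - r) ^ (b - 1)) p.2)
      ((volume.restrict (Ioc 0 t)).prod (volume.restrict (Ioc 0 t))) := by
  have hmeas : Measurable fun p : ℝ × ℝ => (t - p.1) ^ (a - 1) *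
      (Iio p.1).indicator (fun r => (p.1 - r) ^ (b - 1)) p.2 := by
    refine Measurable.mul (by fun_prop) ?_
    have : (fun p : ℝ × ℝ => (Iio p.1).indicator (fun r => (p.1 - r) ^ (b - 1)) p.2)
        = {p : ℝ × ℝ | p.2 < p.1}.indicator fun p => (p.1 - p.2) ^ (b - 1) := by
      ext p; simp [indicator]
    rw [this]
    exact Measurable.indicator (by fun_prop) (measurableSet_lt measurable_snd measurable_fst)
  have hker : ∀ s ∈ Ioc 0 t, IntegrableOn ((Iio s).indicator fun r => (s - r) ^ (b - 1)) (Ioc 0 t)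
      ∧ ∫ r in Ioc 0 t, (Iio s).indicator (fun r => (s - r) ^ (b - 1)) r = s ^ b / b := by
    intro s hs
    have hset : Ioc 0 t ∩ Iio s = Ioo 0 s := by
      ext r; simp only [mem_inter_iff, mem_Ioc, mem_Iio, mem_Ioo]
      exact ⟨fun h => ⟨h.1.1, h.2⟩, fun h => ⟨⟨h.1, h.2.le.trans hs.2⟩, h.2⟩⟩
    constructor
    · rw [IntegrableOn, integrable_indicator_iff measurableSet_Iio, IntegrableOn,
        Measure.restrict_restrict measurableSet_Iio, inter_comm, hset]
      exact ((intervalIntegrable_iff_integrableOn_Ioc_of_le hs.1.le).1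
        (intervalIntegrable_sub_rpow hb 0 s)).mono_set Ioo_subset_Ioc_self
    · rw [setIntegral_indicator measurableSet_Iio, hset, ← integral_Ioc_eq_integral_Ioo,
        ← intervalIntegral.integral_of_le hs.1.le, integral_sub_rpow hb, sub_zero]
  rw [integrable_prod_iff hmeas.aestronglyMeasurable]
  constructor
  · filter_upwards [ae_restrict_mem measurableSet_Ioc] with s hs
    exact (hker s hs).1.const_mul _
  · have hI : IntegrableOn (fun s => (t - s) ^ (a - 1) * (s ^ b / b)) (Ioc 0 t) := by
      rw [← intervalIntegrable_iff_integrableOn_Ioc_of_le ht]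
      exact (intervalIntegrable_sub_rpow ha 0 t).mul_continuousOn
        ((Real.continuous_rpow_const hb.le).div_const b).continuousOn
    refine Integrable.congr hI ?_
    filter_upwards [ae_restrict_mem measurableSet_Ioc] with s hs
    rw [← (hker s hs).2, ← integral_const_mul]
    refine integral_congr_ae (Filter.Eventually.of_forall fun r => ?_)
    refine (Real.norm_of_nonneg (mul_nonneg (Real.rpow_nonneg (sub_nonneg.2 hs.2) _) ?_)).symm
    exact indicator_nonneg (fun r hr => Real.rpow_nonneg (sub_nonneg.2 (le_of_lt hr)) _) r

/-- Swap the integrals over the triangle r < s ≤ t; the inner one becomes a Beta integral. -/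
lemma rlIntegral_rlIntegral_of_continuous {a b : ℝ} (ha : 0 < a) (hb : 0 < b) {f : ℝ → ℝ}
    (hf : Continuous f) {M : ℝ} (hM : ∀ s, |f s| ≤ M) {t : ℝ} (ht : 0 ≤ t) :
    rlIntegral a (rlIntegral b f) t = rlIntegral (a + b) f t := by
  have hint := (integrable_iterated_kernel ha hb ht).mul_bdd (c := M)
    (g := fun p : ℝ × ℝ => f p.2) (by fun_prop)
    (Filter.Eventually.of_forall fun p => hM p.2)
  have hswap := integral_integral_swap (f := fun s r => (t - s) ^ (a - 1) *
        (Iio s).indicator (fun r => (s - r) ^ (b - 1)) r * f r) hint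
  have hleft : ∫ s in Ioc 0 t, ∫ r in Ioc 0 t, (t - s) ^ (a - 1) *
        (Iio s).indicator (fun r => (s - r) ^ (b - 1)) r * f r
      = ∫ s in Ioc 0 t, (t - s) ^ (a - 1) * ∫ r in (0 : ℝ)..s, (s - r) ^ (b - 1) * f r := by
    refine setIntegral_congr_fun measurableSet_Ioc fun s hs => ?_
    have hset : Ioc 0 t ∩ Iio s = Ioo 0 s := by
      ext r; simp only [mem_inter_iff, mem_Ioc, mem_Iio, mem_Ioo]
      exact ⟨fun h => ⟨h.1.1, h.2⟩, fun h => ⟨⟨h.1, h.2.le.trans hs.2⟩, h.2⟩⟩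
    simp only [mul_assoc]
    rw [integral_const_mul, intervalIntegral.integral_of_le hs.1.le,
      integral_Ioc_eq_integral_Ioo (x := 0) (y := s), ← hset, ← setIntegral_indicator measurableSet_Iio]
    simp only [indicator_mul_left]
  have hright : ∫ r in Ioc 0 t, ∫ s in Ioc 0 t, (t - s) ^ (a - 1) *
        (Iio s).indicator (fun r => (s - r) ^ (b - 1)) r * f r
      = ∫ r in Ioc 0 t, (Real.Gamma a * Real.Gamma b / Real.Gamma (a + b)) *
          ((t - r) ^ (a + b - 1) * f r) := by
    -- The endpoint r = t is dropped: when a + b = 1 the right integrand there contains 0 ^ 0 = 1,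
    -- while the left one vanishes.
    rw [integral_Ioc_eq_integral_Ioo, integral_Ioc_eq_integral_Ioo]
    refine setIntegral_congr_fun measurableSet_Ioo fun r hr => ?_
    have hset : Ioc 0 t ∩ Ioi r = Ioc r t := by
      ext s; simp only [mem_inter_iff, mem_Ioc, mem_Ioi]
      exact ⟨fun h => ⟨h.2, h.1.2⟩, fun h => ⟨⟨hr.1.trans h.1, h.2⟩, h.1⟩⟩
    have hind : ∀ s, (t - s) ^ (a - 1) * (Iio s).indicator (fun r => (s - r) ^ (b - 1)) r
        = (Ioi r).indicator (fun s => (t - s) ^ (a - 1) * (s - r) ^ (b - 1)) s := by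
      intro s
      simp [indicator]
    simp only [hind]
    rw [integral_mul_const, setIntegral_indicator measurableSet_Ioi, hset,
      ← intervalIntegral.integral_of_le hr.2.le, integral_rpow_mul_rpow ha hb hr.2]
    ring
  rw [hleft, hright, integral_const_mul, ← intervalIntegral.integral_of_le ht,
    ← intervalIntegral.integral_of_le ht] at hswap
  have ha' := (Real.Gamma_pos_of_pos ha).ne'
  have hb' := (Real.Gamma_pos_of_pos hb).ne'
  have hfac : ∫ s in (0 : ℝ)..t, (t - s) ^ (a - 1) *
      (1 / Real.Gamma b * ∫ r in (0 : ℝ)..s, (s - r) ^ (b - 1) * f r)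
      = 1 / Real.Gamma b * ∫ s in (0 : ℝ)..t, (t - s) ^ (a - 1) *
        ∫ r in (0 : ℝ)..s, (s - r) ^ (b - 1) * f r := by
    rw [← intervalIntegral.integral_const_mul]
    simp_rw [mul_left_comm (1 / Real.Gamma b)]
  unfold rlIntegral
  rw [hfac, hswap]
  field_simp

/-- The semigroup property of fractional integration on `C[0, T]`. -/
lemma rlIntegral_rlIntegral {a b T : ℝ} (ha : 0 < a) (hb : 0 < b) {f : ℝ → ℝ}
    (hf : ContinuousOn f (Icc 0 T)) {t : ℝ} (ht : t ∈ Icc 0 T) :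
    rlIntegral a (rlIntegral b f) t = rlIntegral (a + b) f t := by
  obtain ⟨g, hg, hfg, M, hM⟩ := exists_continuous_extension (ht.1.trans ht.2) hf
  rw [rlIntegral_congr (a + b) hfg ht, rlIntegral_congr a (rlIntegral_congr b hfg) ht]
  exact rlIntegral_rlIntegral_of_continuous ha hb hg hM ht.1

/-! ### Reduction to a Volterra equation -/

lemma hasDerivWithinAt_rlIntegral_one {T : ℝ} {h : ℝ → ℝ} (hh : ContinuousOn h (Icc 0 T))
    {t : ℝ} (ht : t ∈ Icc 0 T) : HasDerivWithinAt (rlIntegral 1 h) (h t) (Icc 0 T) t := by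
  have := Fact.mk ht
  have hint : IntervalIntegrable h volume 0 t := by
    refine ContinuousOn.intervalIntegrable (hh.mono ?_)
    rw [uIcc_of_le ht.1]
    exact Icc_subset_Icc le_rfl ht.2
  refine (intervalIntegral.integral_hasDerivWithinAt_right hint (t := Icc 0 T)
    (hh.stronglyMeasurableAtFilter_nhdsWithin measurableSet_Icc t) (hh t ht)).congr
    (fun s _ => rlIntegral_one h s) (rlIntegral_one h t)

lemma eqOn_of_rlIntegral_one_eqOn {T : ℝ} (hT : 0 < T) {h k : ℝ → ℝ}
    (hh : ContinuousOn h (Icc 0 T)) (hk : ContinuousOn k (Icc 0 T))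
    (heq : EqOn (rlIntegral 1 h) (rlIntegral 1 k) (Icc 0 T)) : EqOn h k (Icc 0 T) := fun t ht =>
  (uniqueDiffOn_Icc hT t ht).eq_deriv _ (hasDerivWithinAt_rlIntegral_one hh ht)
    ((hasDerivWithinAt_rlIntegral_one hk ht).congr heq (heq ht))

/-- A continuous function solves the fractional Voigt problem if and only if it solves the Volterra
equation `x = I^α (φ - lam x)`. -/
lemma solvesVoigt_iff_volterra {α lam T : ℝ} (hα0 : 0 < α) (hα1 : α < 1) (hT : 0 < T)
    {φ x : ℝ → ℝ} (hφ : ContinuousOn φ (Icc 0 T)) (hx : ContinuousOn x (Icc 0 T)) :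
    SolvesVoigt α lam T φ x ↔
      EqOn x (rlIntegral α fun s => φ s - lam * x s) (Icc 0 T) := by
  have hα' : 0 < 1 - α := sub_pos.2 hα1
  have hg : ContinuousOn (fun s => φ s - lam * x s) (Icc 0 T) :=
    hφ.sub (continuousOn_const.mul hx)
  constructor
  · rintro ⟨hD, hx0⟩
    have hderiv : ∀ t ∈ Ioc 0 T,
        HasDerivWithinAt (rlIntegral (1 - α) x) (φ t - lam * x t) (Icc 0 T) t := by
      intro t ht
      obtain ⟨d, hd, hdx⟩ := hD t ht
      rw [HasCaputoDerivAt, hx0] at hd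
      simp only [sub_zero] at hd
      rwa [← hdx, add_sub_cancel_right]
    have hF : EqOn (rlIntegral (1 - α) x) (rlIntegral 1 fun s => φ s - lam * x s) (Icc 0 T) := by
      intro t ht
      have hsub : Icc 0 t ⊆ Icc 0 T := Icc_subset_Icc le_rfl ht.2
      -- The equation says nothing at 0, so this form of the fundamental theorem asks only for
      -- continuity there.
      have h := intervalIntegral.integral_eq_sub_of_hasDeriv_right_of_le ht.1
        ((continuousOn_rlIntegral hα' hx).mono hsub)
        (fun s hs => ((hderiv s ⟨hs.1, hs.2.le.trans ht.2⟩).mono_of_mem_nhdsWithin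
          (mem_nhdsWithin_of_mem_nhds (Icc_mem_nhds hs.1 (hs.2.trans_le ht.2)))))
        (ContinuousOn.intervalIntegrable (by rw [uIcc_of_le ht.1]; exact hg.mono hsub))
      rw [rlIntegral_one, h, rlIntegral_zero_right, sub_zero]
    -- With g = φ - λx: I^1 I^α g = I^α I^1 g = I^α I^(1-α) x = I^1 x; differentiating removes I^1.
    refine eqOn_of_rlIntegral_one_eqOn hT hx (continuousOn_rlIntegral hα0 hg) fun t ht => ?_
    rw [rlIntegral_rlIntegral one_pos hα0 hg ht, add_comm,
      ← rlIntegral_rlIntegral hα0 one_pos hg ht, ← rlIntegral_congr α hF ht,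
      rlIntegral_rlIntegral hα0 hα' hx ht, add_sub_cancel]
  · intro h
    have hx0 : x 0 = 0 := by rw [h ⟨le_rfl, hT.le⟩, rlIntegral_zero_right]
    have hF : EqOn (rlIntegral (1 - α) x) (rlIntegral 1 fun s => φ s - lam * x s) (Icc 0 T) := by
      intro t ht
      rw [rlIntegral_congr (1 - α) h ht, rlIntegral_rlIntegral hα' hα0 hg ht, sub_add_cancel]
    refine ⟨fun t ht => ⟨φ t - lam * x t, ?_, sub_add_cancel _ _⟩, hx0⟩
    have ht' := Ioc_subset_Icc_self ht
    simp only [HasCaputoDerivAt, hx0, sub_zero]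
    exact (hasDerivWithinAt_rlIntegral_one hg ht').congr hF (hF ht')

/-! ### Convergence of the Mittag-Leffler series -/

/-- Keep only (R, R + 1] in the Gamma integral. As R is free, Γ beats any geometric growth. -/
lemma rpow_mul_exp_le_Gamma {R y : ℝ} (hR : 0 < R) (hy : 0 < y) :
    R ^ y * Real.exp (-(R + 1)) ≤ Real.Gamma (y + 1) := by
  have hint := Real.GammaIntegral_convergent (s := y + 1) (by linarith)
  have hsub : Ioc R (R + 1) ⊆ Ioi 0 := fun x hx => hR.trans hx.1
  rw [Real.Gamma_eq_integral (by linarith)]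
  calc R ^ y * Real.exp (-(R + 1)) = ∫ _ in Ioc R (R + 1), R ^ y * Real.exp (-(R + 1)) := by simp
    _ ≤ ∫ x in Ioc R (R + 1), Real.exp (-x) * x ^ (y + 1 - 1) := by
      refine setIntegral_mono_on (integrableOn_const (by simp)) (hint.mono_set hsub) measurableSet_Ioc fun x hx => ?_
      rw [add_sub_cancel_right, mul_comm]
      gcongr
      · exact hx.2
      · exact hx.1.le
    _ ≤ _ := by
      refine setIntegral_mono_set hint ?_ hsub.eventuallyLE
      filter_upwards [ae_restrict_mem measurableSet_Ioi] with x hx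
      exact mul_nonneg (Real.exp_pos _).le (Real.rpow_nonneg (le_of_lt hx) _)

lemma summable_pow_div_Gamma {α β : ℝ} (hα : 0 < α) (hβ : 0 < β) (c : ℝ) :
    Summable fun n : ℕ => c ^ n / Real.Gamma (α * n + β) := by
  -- With R ^ α = D ≥ 2|c| the terms are O((αn + β) / 2^n); the linear factor comes from Γ(y + 1) =
  -- y Γ(y).
  set D : ℝ := 2 * (|c| + 1)
  have hD : 0 < D := by positivity
  set R : ℝ := D ^ α⁻¹
  have hR : 0 < R := Real.rpow_pos_of_pos hD _
  have hRα : R ^ α = D := Real.rpow_inv_rpow hD.le hα.ne'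
  have hsum : Summable fun n : ℕ =>
      (α * (n * (1 / 2 : ℝ) ^ n) + β * (1 / 2 : ℝ) ^ n) * (Real.exp (R + 1) / R ^ β) := by
    refine Summable.mul_right _ (Summable.add (Summable.mul_left _ ?_) (Summable.mul_left _ ?_))
    · simpa using summable_pow_mul_geometric_of_norm_lt_one 1
        (show ‖(1 / 2 : ℝ)‖ < 1 by norm_num)
    · exact summable_geometric_two
  refine Summable.of_norm_bounded hsum fun n => ?_
  have hy : 0 < α * n + β := by positivity
  have hG := rpow_mul_exp_le_Gamma hR hy
  rw [Real.Gamma_add_one hy.ne', Real.rpow_add hR, Real.rpow_mul hR.le, hRα, Real.rpow_natCast,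
    Real.exp_neg] at hG
  have hΓ := Real.Gamma_pos_of_pos hy
  have hRβ : 0 < R ^ β := Real.rpow_pos_of_pos hR _
  have he := Real.exp_pos (R + 1)
  have hc : |c| ^ n ≤ (1 / 2) ^ n * D ^ n := by
    rw [← mul_pow]
    refine pow_le_pow_left₀ (abs_nonneg c) ?_ n
    simp only [D]; linarith
  rw [norm_div, norm_pow, Real.norm_eq_abs, Real.norm_of_nonneg hΓ.le, div_le_iff₀ hΓ]
  calc |c| ^ n ≤ (1 / 2) ^ n * D ^ n := hc
    _ = (1 / 2) ^ n * (Real.exp (R + 1) / R ^ β) * (D ^ n * R ^ β * (Real.exp (R + 1))⁻¹) := by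
      field_simp
    _ ≤ (1 / 2) ^ n * (Real.exp (R + 1) / R ^ β) * ((α * n + β) * Real.Gamma (α * n + β)) := by
      gcongr
    _ = _ := by ring

lemma continuous_mittagLeffler {α β : ℝ} (hα : 0 < α) (hβ : 0 < β) :
    Continuous (mittagLeffler α β) := by
  refine continuous_iff_continuousAt.2 fun z => ?_
  have hon : ContinuousOn (mittagLeffler α β) (Icc (-(|z| + 1)) (|z| + 1)) := by
    refine continuousOn_tsum (fun n => by fun_prop) (summable_pow_div_Gamma hα hβ (|z| + 1))
      fun n w hw => ?_
    have hΓ : 0 < Real.Gamma (α * n + β) := Real.Gamma_pos_of_pos (by positivity)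
    rw [norm_div, norm_pow, Real.norm_of_nonneg hΓ.le, Real.norm_eq_abs]
    have := abs_le.2 hw
    gcongr
  refine hon.continuousAt (Icc_mem_nhds ?_ ?_)
  · linarith [neg_abs_le z]
  · linarith [le_abs_self z]

/-! ### The strain as a Neumann series -/

lemma intervalIntegrable_alphaExp_mul {α μ T : ℝ} (hα : 0 < α) {φ : ℝ → ℝ}
    (hφ : ContinuousOn φ (Icc 0 T)) {t : ℝ} (ht : t ∈ Icc 0 T) :
    IntervalIntegrable (fun s => alphaExp α μ (t - s) * φ s) volume 0 t := by
  have hE : Continuous fun s : ℝ => mittagLeffler α α (μ * (t - s) ^ α) :=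
    (continuous_mittagLeffler hα hα).comp
      (continuous_const.mul ((Real.continuous_rpow_const hα.le).comp (by fun_prop)))
  have h := intervalIntegrable_sub_rpow_mul hα (hE.continuousOn.mul hφ) ht
  refine h.congr fun s _ => ?_
  simp only [alphaExp, mul_assoc, Pi.mul_apply]

lemma rpow_mul_natCast_add_sub_one {x : ℝ} (hx : 0 < x) (α : ℝ) (n : ℕ) :
    x ^ (α * n + α - 1) = (x ^ α) ^ n * x ^ (α - 1) := by
  rw [add_sub_assoc, Real.rpow_add hx, Real.rpow_mul hx.le, Real.rpow_natCast]

lemma hasSum_strain {α lam T : ℝ} (hα : 0 < α) (hlam : 0 < lam) {φ : ℝ → ℝ}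
    (hφ : ContinuousOn φ (Icc 0 T)) {t : ℝ} (ht : t ∈ Icc 0 T) :
    HasSum (fun n : ℕ => (-lam) ^ n * rlIntegral (α * n + α) φ t) (strain α lam φ t) := by
  obtain ⟨M, hM⟩ := isCompact_Icc.exists_bound_of_continuousOn hφ
  have hpos : ∀ n : ℕ, 0 < α * n + α := fun n => by positivity
  -- Splitting the power of t - s into factors needs t - s > 0.
  have hne : ∀ᵐ s : ℝ, s ≠ t := compl_mem_ae_iff.2 (measure_singleton t)
  have hsum := summable_pow_div_Gamma hα hα (lam * t ^ α)
  have key := intervalIntegral.hasSum_integral_of_dominated_convergence (μ := volume)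
    (a := 0) (b := t)
    (F := fun (n : ℕ) s => (-lam) ^ n / Real.Gamma (α * n + α) *
      ((t - s) ^ (α * n + α - 1) * φ s))
    (f := fun s => alphaExp α (-lam) (t - s) * φ s)
    (fun n s => (lam * t ^ α) ^ n / Real.Gamma (α * n + α) * ((t - s) ^ (α - 1) * M))
    (fun n => ?_) ?_ ?_ ?_ ?_
  · have hterm : (fun n : ℕ => (-lam) ^ n * rlIntegral (α * n + α) φ t) = fun n : ℕ =>
        ∫ s in (0 : ℝ)..t, (-lam) ^ n / Real.Gamma (α * n + α) *
          ((t - s) ^ (α * n + α - 1) * φ s) := by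
      funext n
      rw [intervalIntegral.integral_const_mul, rlIntegral]
      ring
    rw [hterm]
    exact key
  · rw [uIoc_of_le ht.1]
    exact ((intervalIntegrable_sub_rpow_mul (hpos n) hφ ht).const_mul _).1.aestronglyMeasurable
  · intro n
    filter_upwards [hne] with s hst hs
    rw [uIoc_of_le ht.1] at hs
    have hts : 0 < t - s := sub_pos.2 (lt_of_le_of_ne hs.2 hst)
    have hΓ := Real.Gamma_pos_of_pos (hpos n)
    rw [rpow_mul_natCast_add_sub_one hts, norm_mul, norm_mul, norm_div, norm_pow, norm_neg,
      Real.norm_of_nonneg hlam.le, Real.norm_of_nonneg hΓ.le,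
      Real.norm_of_nonneg (by positivity), mul_pow]
    have h1 : ((t - s) ^ α) ^ n ≤ (t ^ α) ^ n := by
      have := hs.1.le
      gcongr
      linarith
    have h2 : ‖φ s‖ ≤ M := hM s ⟨hs.1.le, hs.2.trans ht.2⟩
    calc lam ^ n / Real.Gamma (α * n + α) * (((t - s) ^ α) ^ n * (t - s) ^ (α - 1) * ‖φ s‖)
        ≤ lam ^ n / Real.Gamma (α * n + α) * ((t ^ α) ^ n * (t - s) ^ (α - 1) * M) := by
          have := ht.1
          gcongr
      _ = _ := by ring
  · exact Filter.Eventually.of_forall fun s _ => hsum.mul_right _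
  · simp_rw [tsum_mul_right]
    exact ((intervalIntegrable_sub_rpow hα 0 t).mul_const M).const_mul _
  · filter_upwards [hne] with s hst hs
    rw [uIoc_of_le ht.1] at hs
    have hts : 0 < t - s := sub_pos.2 (lt_of_le_of_ne hs.2 hst)
    have h := ((summable_pow_div_Gamma hα hα (-lam * (t - s) ^ α)).hasSum.mul_left
      ((t - s) ^ (α - 1))).mul_right (φ s)
    convert! h using 2 with n
    rw [rpow_mul_natCast_add_sub_one hts, mul_pow]
    ring

/-- A summable majorant independent of t, written to match `summable_pow_div_Gamma` with β = α + 1.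
-/
lemma abs_pow_mul_rlIntegral_le {α lam T M : ℝ} (hα : 0 < α) (hlam : 0 < lam) {φ : ℝ → ℝ}
    (hM : ∀ s ∈ Icc 0 T, |φ s| ≤ M) {t : ℝ} (ht : t ∈ Icc 0 T) (n : ℕ) :
    |(-lam) ^ n * rlIntegral (α * n + α) φ t|
      ≤ M * T ^ α * ((lam * T ^ α) ^ n / Real.Gamma (α * n + (α + 1))) := by
  have hpos : 0 < α * n + α := by positivity
  have hT := ht.1.trans ht.2
  have hM0 := (abs_nonneg _).trans (hM t ht)
  have hΓ : 0 < Real.Gamma (α * n + α + 1) := Real.Gamma_pos_of_pos (by positivity)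
  rw [abs_mul, abs_pow, abs_neg, abs_of_pos hlam, ← add_assoc]
  calc lam ^ n * |rlIntegral (α * n + α) φ t|
      ≤ lam ^ n * (M * T ^ (α * n + α) / Real.Gamma (α * n + α + 1)) := by
        have := abs_rlIntegral_le hpos hM ht
        have := ht.1
        have := ht.2
        refine mul_le_mul_of_nonneg_left (‹|_| ≤ _›.trans ?_) (by positivity)
        gcongr
    _ = _ := by
        rw [Real.rpow_add_of_nonneg hT (by positivity) hα.le, Real.rpow_mul hT, Real.rpow_natCast,
          mul_pow]
        ring

lemma continuousOn_strain {α lam T : ℝ} (hα : 0 < α) (hlam : 0 < lam) {φ : ℝ → ℝ}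
    (hφ : ContinuousOn φ (Icc 0 T)) : ContinuousOn (strain α lam φ) (Icc 0 T) := by
  obtain ⟨M, hM⟩ := isCompact_Icc.exists_bound_of_continuousOn hφ
  refine ContinuousOn.congr (f := fun t => ∑' n : ℕ, (-lam) ^ n * rlIntegral (α * n + α) φ t)
    (continuousOn_tsum (fun n => ?_)
      ((summable_pow_div_Gamma hα (by linarith : 0 < α + 1) (lam * T ^ α)).mul_left (M * T ^ α))
      fun n t ht => abs_pow_mul_rlIntegral_le hα hlam hM ht n)
    fun t ht => (hasSum_strain hα hlam hφ ht).tsum_eq.symm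
  exact continuousOn_const.mul (continuousOn_rlIntegral (by positivity) hφ)

lemma rlIntegral_sub_const_mul {b T : ℝ} (hb : 0 < b) (c : ℝ) {f g : ℝ → ℝ}
    (hf : ContinuousOn f (Icc 0 T)) (hg : ContinuousOn g (Icc 0 T)) {t : ℝ} (ht : t ∈ Icc 0 T) :
    rlIntegral b (fun s => f s - c * g s) t = rlIntegral b f t - c * rlIntegral b g t := by
  rw [rlIntegral_sub hb hf (g := fun s => c * g s) (continuousOn_const.mul hg) ht, rlIntegral_const_mul]

lemma strain_eq_volterra {α lam T : ℝ} (hα : 0 < α) (hlam : 0 < lam) {φ : ℝ → ℝ}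
    (hφ : ContinuousOn φ (Icc 0 T)) :
    EqOn (strain α lam φ) (rlIntegral α fun s => φ s - lam * strain α lam φ s) (Icc 0 T) := by
  intro t ht
  have hS := continuousOn_strain hα hlam hφ
  obtain ⟨M, hM⟩ := isCompact_Icc.exists_bound_of_continuousOn hφ
  have hpos : ∀ n : ℕ, 0 < α * n + α := fun n => by positivity
  have ha : ∀ n : ℕ, ContinuousOn (fun s => (-lam) ^ n * rlIntegral (α * n + α) φ s) (Icc 0 T) :=
    fun n => continuousOn_const.mul (continuousOn_rlIntegral (hpos n) hφ)
  have hB := (summable_pow_div_Gamma hα (by linarith : 0 < α + 1) (lam * T ^ α)).mul_left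
    (M * T ^ α)
  have hmem : ∀ s ∈ uIoc 0 t, s ∈ Icc 0 T ∧ 0 ≤ t - s := by
    intro s hs
    rw [uIoc_of_le ht.1] at hs
    exact ⟨⟨hs.1.le, hs.2.trans ht.2⟩, sub_nonneg.2 hs.2⟩
  have key := intervalIntegral.hasSum_integral_of_dominated_convergence (μ := volume)
    (a := 0) (b := t)
    (F := fun (n : ℕ) s => (t - s) ^ (α - 1) * ((-lam) ^ n * rlIntegral (α * n + α) φ s))
    (f := fun s => (t - s) ^ (α - 1) * strain α lam φ s)
    (fun n s => (t - s) ^ (α - 1) *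
      (M * T ^ α * ((lam * T ^ α) ^ n / Real.Gamma (α * n + (α + 1)))))
    (fun n => ?_) (fun n => ?_) ?_ ?_ ?_
  · have h1 : HasSum (fun n : ℕ => -lam * rlIntegral α
        (fun s => (-lam) ^ n * rlIntegral (α * n + α) φ s) t)
        (-lam * rlIntegral α (strain α lam φ) t) := (key.mul_left _).mul_left _
    -- Removing the n = 0 term I^α φ leaves the series for -λ I^α applied to the strain.
    have h2 := (hasSum_nat_add_iff' 1).2 (hasSum_strain hα hlam hφ ht)
    have h3 : (fun n : ℕ => (-lam) ^ (n + 1) * rlIntegral (α * (n + 1 : ℕ) + α) φ t)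
        = fun n : ℕ => -lam * rlIntegral α
        (fun s => (-lam) ^ n * rlIntegral (α * n + α) φ s) t := by
      funext n
      rw [rlIntegral_const_mul, rlIntegral_rlIntegral hα (hpos n) hφ ht, pow_succ']
      push_cast
      ring_nf
    rw [h3] at h2
    have h4 := h2.unique h1
    simp only [Finset.range_one, Finset.sum_singleton, pow_zero, Nat.cast_zero, mul_zero, zero_add,
      one_mul] at h4
    rw [rlIntegral_sub_const_mul hα lam hφ hS ht]
    linarith
  · rw [uIoc_of_le ht.1]
    exact (intervalIntegrable_sub_rpow_mul hα (ha n) ht).1.aestronglyMeasurable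
  · refine Filter.Eventually.of_forall fun s hs => ?_
    rw [norm_mul, Real.norm_of_nonneg (Real.rpow_nonneg (hmem s hs).2 _)]
    exact mul_le_mul_of_nonneg_left (abs_pow_mul_rlIntegral_le hα hlam hM (hmem s hs).1 n)
      (Real.rpow_nonneg (hmem s hs).2 _)
  · exact Filter.Eventually.of_forall fun s _ => hB.mul_left _
  · simp_rw [tsum_mul_left]
    exact (intervalIntegrable_sub_rpow hα 0 t).mul_const _
  · exact Filter.Eventually.of_forall fun s hs =>
      (hasSum_strain hα hlam hφ (hmem s hs).1).mul_left _

/-! ### Uniqueness -/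

lemma eqOn_zero_of_eqOn_rlIntegral {α lam T : ℝ} (hα : 0 < α) (hlam : 0 < lam) {y : ℝ → ℝ}
    (hy : ContinuousOn y (Icc 0 T)) (h : EqOn y (fun t => -lam * rlIntegral α y t) (Icc 0 T)) :
    EqOn y 0 (Icc 0 T) := by
  obtain ⟨M, hM⟩ := isCompact_Icc.exists_bound_of_continuousOn hy
  -- One factor -λ is kept outside so that the rest is the quantity bounded by
  -- `abs_pow_mul_rlIntegral_le`.
  have hiter : ∀ n : ℕ, ∀ t ∈ Icc 0 T, y t = -lam * ((-lam) ^ n * rlIntegral (α * n + α) y t) := by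
    intro n
    induction n with
    | zero => intro t ht; simpa using h ht
    | succ n ih =>
      intro t ht
      have hpos : 0 < α * n + α := by positivity
      rw [ih t ht, rlIntegral_congr _ h ht, rlIntegral_const_mul,
        rlIntegral_rlIntegral hpos hα hy ht]
      push_cast
      ring_nf
  intro t ht
  have hB := ((summable_pow_div_Gamma hα (by linarith : 0 < α + 1) (lam * T ^ α)).mul_left
    (M * T ^ α)).tendsto_atTop_zero
  have h0 := (squeeze_zero_norm (fun n => abs_pow_mul_rlIntegral_le hα hlam hM ht n) hB).const_mul
    (-lam)
  rw [mul_zero] at h0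
  exact tendsto_nhds_unique (tendsto_const_nhds.congr fun n => hiter n t ht) h0

lemma eqOn_of_volterra {α lam T : ℝ} (hα : 0 < α) (hlam : 0 < lam) {φ x z : ℝ → ℝ}
    (hφ : ContinuousOn φ (Icc 0 T)) (hx : ContinuousOn x (Icc 0 T)) (hz : ContinuousOn z (Icc 0 T))
    (hxV : EqOn x (rlIntegral α fun s => φ s - lam * x s) (Icc 0 T))
    (hzV : EqOn z (rlIntegral α fun s => φ s - lam * z s) (Icc 0 T)) : EqOn x z (Icc 0 T) := by
  intro t ht
  refine sub_eq_zero.1 (eqOn_zero_of_eqOn_rlIntegral hα hlam (hx.sub hz) (fun s hs => ?_) ht)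
  have h1 := hxV hs
  have h2 := hzV hs
  rw [rlIntegral_sub_const_mul hα lam hφ hx hs] at h1
  rw [rlIntegral_sub_const_mul hα lam hφ hz hs] at h2
  have h3 := rlIntegral_sub hα hx hz hs
  change x s - z s = -lam * rlIntegral α (fun s => x s - z s) s
  rw [h3, h1, h2]
  ring

theorem theorem1 (α lam T : ℝ) (hα0 : 0 < α) (hα1 : α < 1) (hlam : 0 < lam) (hT : 0 < T)
    (φ : ℝ → ℝ) (hφ : ContinuousOn φ (Icc 0 T)) :
    (∀ t ∈ Icc 0 T,
      IntervalIntegrable (fun s => alphaExp α (-lam) (t - s) * φ s) volume 0 t) ∧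
    (ContinuousOn (strain α lam φ) (Icc 0 T) ∧ SolvesVoigt α lam T φ (strain α lam φ)) ∧
    (∀ x : ℝ → ℝ, ContinuousOn x (Icc 0 T) →
      (SolvesVoigt α lam T φ x ↔ ∀ t ∈ Icc 0 T, x t = strain α lam φ t)) := by
  have hS := continuousOn_strain hα0 hlam hφ
  have hV := strain_eq_volterra hα0 hlam hφ
  refine ⟨fun t ht => intervalIntegrable_alphaExp_mul hα0 hφ ht,
    ⟨hS, (solvesVoigt_iff_volterra hα0 hα1 hT hφ hS).2 hV⟩, fun x hx => ?_⟩
  rw [solvesVoigt_iff_volterra hα0 hα1 hT hφ hx]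
  refine ⟨fun h => eqOn_of_volterra hα0 hlam hφ hx hS h hV, fun h t ht => ?_⟩
  rw [h t ht, hV ht]
  refine rlIntegral_congr α (fun s hs => ?_) ht
  simp only [h s hs]
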